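/- Let $c_0$ be the space of real sequences converging to $0$ with the supremum norm and its Borel $\sigma$-algebra. For a countable set $V$ in a normed space, $\delta>0$ and $p\in(0,1)$, let $\mathrm{LARG}(V,\delta,p)$ be the random graph with vertex set $V$ in which each pair of distinct $u,v\in V$ with $\|u-v\|<\delta$ is joined by an edge independently with probability $p$, and no other pair is joined. A countable dense set $V$ is called Rado if for all $\delta>0$ and all $p\in(0,1)$ there is a graph $R$ (which may depend on $V,\delta,p$) such that $\mathrm{LARG}(V,\delta,p)$ is isomorphic to $R$ with probability $1$. Theorem. Let $\mu$ be a Borel probability measure on $c_0$ that is non-aligned ($\mu\{x\in c_0: x_j=\alpha\}=0$ for all $j\in\mathbb N$ and $\alpha\in\mathbb R$), fully supported ($\mu(U)>0$ for every non-empty open $U\subseteq c_0$) and of product type (regarded as a measure on $\mathbb R^{\mathbb N}$, $\mu=\prod_{n}\nu_n$ for some probability measures $\nu_n$ on $\mathbb R$). Then for $\mu^{\mathbb N}$-almost every sequence $(x^{(i)})_{i\in\mathbb N}$ of points of $c_0$, the set $\{x^{(i)}: i\in\mathbb N\}$ is Rado (in particular, dense in $c_0$). -/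

import Mathlib

open MeasureTheory
open scoped ZeroAtInfty

noncomputable section

namespace RadoSets

/-- The graph on `V` joining any two distinct points of `V` at distance less than `δ`. -/
def nearGraph {X : Type*} [NormedAddCommGroup X] (V : Set X) (δ : ℝ) : SimpleGraph V where
  Adj u v := u ≠ v ∧ ‖(u : X) - (v : X)‖ < δ
  symm := ⟨fun u v h => ⟨h.1.symm, by rw [norm_sub_rev]; exact h.2⟩⟩
  loopless := ⟨fun _ h => h.1 rfl⟩

/-- The Local Area Random Graph `LARG(V, δ, p)`, as a law on the graphs with vertex set `V`:
each pair of distinct points at distance less than `δ` is an edge with probability `p`, independently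
of all other pairs, and no other pair is an edge. -/
def LARG {X : Type*} [NormedAddCommGroup X] (V : Set X) (δ : ℝ) (p : unitInterval) :
    Measure (SimpleGraph V) :=
  (ProbabilityTheory.setBernoulli (nearGraph V δ).edgeSet p).map SimpleGraph.fromEdgeSet

/-- A countable dense set `V` in a normed space is Rado if for all `δ > 0` and `p ∈ (0, 1)` there is
a single isomorphism type of graphs to which `LARG(V, δ, p)` belongs with probability 1. -/
def IsRado {X : Type*} [NormedAddCommGroup X] (V : Set X) : Prop :=
  V.Countable ∧ Dense V ∧
    ∀ δ : ℝ, 0 < δ → ∀ p : unitInterval, 0 < p → p < 1 →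
      ∃ R : SimpleGraph V, ∀ᵐ G ∂(LARG V δ p), Nonempty (G ≃g R)

/-- `C₀(ℕ, ℝ)`, the functions on the discrete space `ℕ` vanishing at infinity with the supremum
norm, is the space `c₀` of real sequences converging to `0`. A measure on it is non-aligned if every
affine coordinate hyperplane is null. -/
def NonAligned [MeasurableSpace C₀(ℕ, ℝ)] (μ : Measure C₀(ℕ, ℝ)) : Prop :=
  ∀ (j : ℕ) (α : ℝ), μ {x : C₀(ℕ, ℝ) | x j = α} = 0

/-- A measure is fully supported if every non-empty open set has positive measure. -/
def FullySupported {X : Type*} [TopologicalSpace X] [MeasurableSpace X] (μ : Measure X) : Prop :=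
  ∀ U : Set X, IsOpen U → U.Nonempty → 0 < μ U

/-- A measure on `c₀` is of product type if, seen as a measure on `ℝ^ℕ`, it is a product of
probability measures on `ℝ`. -/
def IsProductType [MeasurableSpace C₀(ℕ, ℝ)] (μ : Measure C₀(ℕ, ℝ)) : Prop :=
  ∃ ν : ℕ → Measure ℝ, (∀ n, IsProbabilityMeasure (ν n)) ∧
    μ.map (fun (x : C₀(ℕ, ℝ)) (n : ℕ) => x n) = Measure.infinitePi ν

end RadoSets

end

namespace RadoSets

open ProbabilityTheory Filter
open scoped ENNReal

/-! Two typical samples of the random graph are matched by a back and forth. In c₀ the sup norm is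
attained, so ‖u - v‖ < δ is a condition on each coordinate, visible from the order of the
coordinates and their translates by multiples of δ. A finite partial isomorphism `f` is carried
along with a finite injective matching `K` of coordinates that preserves this order mod δ; at
unmatched coordinates all points involved are smaller than δ/2 and cannot affect the threshold
(`Matching`). To add a point `v`, the finitely many coordinates where it is large are matched first.
At such a coordinate the old points lie in an interval of length δ, so only their order counts, and
that order recurs among their images at infinitely many coordinates. The admissible images of `v`
then contain a nonempty open set, in which local extensibility supplies a vertex with the right
adjacencies. The open set may be empty if `v` is congruent mod δ to an old point in some coordinate.
Genericity confines all such congruences to at most two points, which are too far apart to be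
adjacent; these are fixed from the start. Density, genericity and recurrence of orders hold almost
surely for the sample of points: the first from full support, the second from atomless marginals,
the third from Borel-Cantelli over the independent coordinates, where n samples have a given order
with probability at least 1/n!. -/

/-! ### Null sequences and their coordinates -/

lemma finite_setOf_le_abs {ε : ℝ} (hε : 0 < ε) (x : C₀(ℕ, ℝ)) : {k | ε ≤ |x k|}.Finite := by
  have h0 := x.zero_at_infty'
  rw [Filter.cocompact_eq_cofinite] at h0
  have h1 := h0.eventually (Metric.ball_mem_nhds (0 : ℝ) hε)
  rw [Filter.eventually_cofinite] at h1
  refine h1.subset fun k hk => ?_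
  simpa using hk

/-- The sup norm of a null sequence is attained. -/
lemma norm_lt_iff_forall_abs_lt {δ : ℝ} (hδ : 0 < δ) (x : C₀(ℕ, ℝ)) :
    ‖x‖ < δ ↔ ∀ k, |x k| < δ := by
  constructor
  · intro h k
    exact (x.toBCF.norm_coe_le_norm k).trans_lt h
  · intro h
    have hfin := finite_setOf_le_abs (half_pos hδ) x
    obtain ⟨C, hC, hCδ⟩ : ∃ C : ℝ, (∀ y ∈ insert (δ / 2) (hfin.toFinset.image fun k => |x k|),
        y < C) ∧ ∀ y ∈ ({δ} : Finset ℝ), C < y := by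
      refine Order.exists_between_finsets _ _ fun y hy z hz => ?_
      rw [Finset.mem_singleton.1 hz]
      rcases Finset.mem_insert.1 hy with rfl | hy
      · linarith
      · obtain ⟨k, -, rfl⟩ := Finset.mem_image.1 hy
        exact h k
    refine lt_of_le_of_lt (?_ : ‖x‖ ≤ C) (hCδ δ (by simp))
    have hC0 : δ / 2 < C := hC _ (by simp)
    refine (BoundedContinuousFunction.norm_le (by linarith)).2 fun k => ?_
    by_cases hk : δ / 2 ≤ |x k|
    · exact (hC _ (Finset.mem_insert_of_mem (Finset.mem_image_of_mem _ (by simpa using hk)))).le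
    · exact ((not_le.1 hk).trans hC0).le

/-- The null sequence with finitely many prescribed entries and zeros elsewhere. -/
noncomputable def ofFinsupp (f : ℕ →₀ ℝ) : C₀(ℕ, ℝ) where
  toFun := f
  continuous_toFun := continuous_of_discreteTopology
  zero_at_infty' := by
    rw [Filter.cocompact_eq_cofinite]
    refine tendsto_const_nhds.congr' ?_
    rw [Filter.EventuallyEq, Filter.eventually_cofinite]
    refine f.hasFiniteSupport.subset fun k hk => ?_
    simpa [eq_comm] using hk

@[simp] lemma ofFinsupp_apply (f : ℕ →₀ ℝ) (k : ℕ) : ofFinsupp f k = f k := rfl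

lemma continuous_eval_coord (k : ℕ) : Continuous fun x : C₀(ℕ, ℝ) => x k := by
  have : LipschitzWith 1 fun x : C₀(ℕ, ℝ) => x k := LipschitzWith.of_dist_le_mul fun x y => by
    simpa [ZeroAtInftyContinuousMap.dist_toBCF_eq_dist] using
      BoundedContinuousFunction.dist_coe_le_dist (f := x.toBCF) (g := y.toBCF) k
  exact this.continuous

/-! ### Back and forth -/

/-- Back and forth between countable types, along finite sets of pairs. -/
lemma exists_equiv_of_back_and_forth {α β : Type*} [Countable α] [Countable β]
    (P : Finset (α × β) → Prop) (f₀ : Finset (α × β)) (h₀ : P f₀)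
    (hinj : ∀ f, P f → ∀ p ∈ f, ∀ q ∈ f, p.1 = q.1 ↔ p.2 = q.2)
    (forth : ∀ f, P f → ∀ a, ∃ g, P g ∧ f ⊆ g ∧ ∃ b, (a, b) ∈ g)
    (back : ∀ f, P f → ∀ b, ∃ g, P g ∧ f ⊆ g ∧ ∃ a, (a, b) ∈ g) :
    ∃ e : α ≃ β, ∀ a a', ∃ f, P f ∧ (a, e a) ∈ f ∧ (a', e a') ∈ f := by
  have := Encodable.ofCountable α
  have := Encodable.ofCountable β
  let 𝒟 : α ⊕ β → Order.Cofinal {f // P f} := Sum.elim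
    (fun a => ⟨{f | ∃ b, (a, b) ∈ f.1}, fun f => by
      obtain ⟨g, hg, hfg, h⟩ := forth f.1 f.2 a
      exact ⟨⟨g, hg⟩, h, hfg⟩⟩)
    (fun b => ⟨{f | ∃ a, (a, b) ∈ f.1}, fun f => by
      obtain ⟨g, hg, hfg, h⟩ := back f.1 f.2 b
      exact ⟨⟨g, hg⟩, h, hfg⟩⟩)
  -- A generic ideal meets the domain and range requirement of every point; its directedness makes
  -- the union of its members a bijection.
  let I := Order.idealOfCofinals ⟨f₀, h₀⟩ 𝒟
  have key : ∀ p q : α × β, (∃ f ∈ I, p ∈ f.1) → (∃ f ∈ I, q ∈ f.1) →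
      ∃ f, P f ∧ p ∈ f ∧ q ∈ f := by
    rintro p q ⟨f, hf, hp⟩ ⟨g, hg, hq⟩
    obtain ⟨h, -, hfh, hgh⟩ := I.directed f hf g hg
    exact ⟨h.1, h.2, hfh hp, hgh hq⟩
  have hA : ∀ a, ∃ b, ∃ f ∈ I, (a, b) ∈ f.1 := fun a => by
    obtain ⟨f, ⟨b, hb⟩, hf⟩ := Order.cofinal_meets_idealOfCofinals ⟨f₀, h₀⟩ 𝒟 (Sum.inl a)
    exact ⟨b, f, hf, hb⟩
  have hB : ∀ b, ∃ a, ∃ f ∈ I, (a, b) ∈ f.1 := fun b => by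
    obtain ⟨f, ⟨a, ha⟩, hf⟩ := Order.cofinal_meets_idealOfCofinals ⟨f₀, h₀⟩ 𝒟 (Sum.inr b)
    exact ⟨a, f, hf, ha⟩
  choose F hF using hA
  choose E hE using hB
  refine ⟨⟨F, E, fun a => ?_, fun b => ?_⟩, fun a a' => key _ _ (hF a) (hF a')⟩
  · obtain ⟨f, hf, h1, h2⟩ := key _ _ (hF a) (hE (F a))
    exact ((hinj f hf _ h1 _ h2).2 rfl).symm
  · obtain ⟨f, hf, h1, h2⟩ := key _ _ (hE b) (hF (E b))
    exact ((hinj f hf _ h1 _ h2).1 rfl).symm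


/-! ### Order modulo δ -/

/-- Given finitely many reals `a p` and `b p` with the same order of their `δ`-translates, and `t`
not congruent to any `a p`, the `s` placed among the `b p` as `t` is among the `a p` contain a
nonempty open set. -/
lemma exists_isOpen_same_order {γ : Type*} (f : Finset γ) (a b : γ → ℝ) {δ : ℝ} (hδ : 0 < δ)
    (hab : ∀ p ∈ f, ∀ q ∈ f, ∀ m : ℤ, a p < a q + m * δ ↔ b p < b q + m * δ) (t : ℝ)
    (ht : ∀ p ∈ f, ∀ m : ℤ, t ≠ a p + m * δ) :
    ∃ O : Set ℝ, IsOpen O ∧ O.Nonempty ∧ ∀ s ∈ O, ∀ p ∈ f, ∀ m : ℤ,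
      (t < a p + m * δ ↔ s < b p + m * δ) ∧ (a p < t + m * δ ↔ b p < s + m * δ) := by
  classical
  have hn : ∀ p, ∃ n : ℤ, p ∈ f → a p + (n - 1 : ℤ) * δ < t ∧ t < a p + n * δ := by
    intro p
    refine ⟨⌈(t - a p) / δ⌉, fun hp => ⟨?_, lt_of_le_of_ne ?_ (ht p hp _)⟩⟩
    · have := Int.ceil_lt_add_one ((t - a p) / δ)
      have h2 : ((⌈(t - a p) / δ⌉ - 1 : ℤ) : ℝ) < (t - a p) / δ := by push_cast; linarith
      rw [lt_div_iff₀ hδ] at h2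
      linarith
    · have := Int.le_ceil ((t - a p) / δ)
      rw [div_le_iff₀ hδ] at this
      linarith
  choose n hn using hn
  have mono : ∀ {i j : ℤ}, i ≤ j → (i : ℝ) * δ ≤ j * δ := fun h =>
    mul_le_mul_of_nonneg_right (by exact_mod_cast h) hδ.le
  refine ⟨⋂ p ∈ f, Set.Ioo (b p + (n p - 1 : ℤ) * δ) (b p + n p * δ),
    isOpen_biInter_finset fun p _ => isOpen_Ioo, ?_, ?_⟩
  · obtain ⟨s, hs1, hs2⟩ := Order.exists_between_finsets
      (f.image fun p => b p + (n p - 1 : ℤ) * δ) (f.image fun p => b p + n p * δ) (by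
        simp only [Finset.mem_image]
        rintro _ ⟨p, hp, rfl⟩ _ ⟨q, hq, rfl⟩
        -- A lower bound lies below every upper bound because `t` separates the corresponding
        -- translates on the `a` side.
        have h := (hab p hp q hq (n q - (n p - 1))).1 (by
          have h1 := (hn p hp).1
          have h2 := (hn q hq).2
          push_cast at h1 ⊢
          linarith)
        push_cast at h ⊢
        linarith)
    refine ⟨s, Set.mem_iInter₂.2 fun p hp => ⟨hs1 _ ?_, hs2 _ ?_⟩⟩
    · exact Finset.mem_image_of_mem (fun p => b p + (n p - 1 : ℤ) * δ) hp
    · exact Finset.mem_image_of_mem (fun p => b p + n p * δ) hp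
  · intro s hs p hp m
    obtain ⟨h1, h2⟩ := hn p hp
    obtain ⟨h3, h4⟩ := Set.mem_iInter₂.1 hs p hp
    constructor
    · rcases le_or_gt (n p) m with h | h
      · have := mono h
        exact iff_of_true (by linarith) (by linarith)
      · have := mono (Int.le_sub_one_of_lt h)
        exact iff_of_false (by linarith) (by linarith)
    · rcases le_or_gt (n p) (-m) with h | h
      · have := mono h
        push_cast at this
        exact iff_of_false (by linarith) (by linarith)
      · have := mono (Int.le_sub_one_of_lt h)
        rw [Int.cast_neg] at this
        exact iff_of_true (by linarith) (by linarith)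

/-- Within an interval of length less than `δ`, the order determines the order mod `δ`. -/
lemma lt_add_mul_iff_of_abs_lt {δ a a' b b' : ℝ} (ha : |a| < δ / 2) (ha' : |a'| < δ / 2)
    (hb : |b| < δ / 2) (hb' : |b'| < δ / 2) (h : a < a' ↔ b < b') (m : ℤ) :
    a < a' + m * δ ↔ b < b' + m * δ := by
  rw [abs_lt] at *
  have hδ : 0 < δ := by linarith
  have mono : ∀ {i j : ℤ}, i ≤ j → (i : ℝ) * δ ≤ j * δ := fun h =>
    mul_le_mul_of_nonneg_right (by exact_mod_cast h) hδ.le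
  rcases lt_trichotomy m 0 with hm | rfl | hm
  · have := mono (show m ≤ -1 by omega)
    push_cast at this
    exact iff_of_false (by linarith) (by linarith)
  · simpa using h
  · have := mono (show 1 ≤ m by omega)
    push_cast at this
    exact iff_of_true (by linarith) (by linarith)

/-! ### Matchings of points and coordinates -/

variable {ι : Type*}

/-- Every nonempty open set contains a vertex with a prescribed neighbourhood within a given finite
set, as far as this respects the threshold `δ`. -/
def IsLocallyExtensible (pt : ι → C₀(ℕ, ℝ)) (δ : ℝ) (G : SimpleGraph ι) : Prop :=
  ∀ U : Set C₀(ℕ, ℝ), IsOpen U → U.Nonempty → ∀ A B : Finset ι, Disjoint A B →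
    (∀ a ∈ A, ∀ w, pt w ∈ U → ‖pt w - pt a‖ < δ) →
    ∃ w, pt w ∈ U ∧ w ∉ A ∧ w ∉ B ∧ (∀ a ∈ A, G.Adj w a) ∧ ∀ b ∈ B, ¬ G.Adj w b

/-- Every order of finitely many points is realised by infinitely many coordinates. -/
def HasAllOrders (pt : ι → C₀(ℕ, ℝ)) : Prop :=
  ∀ (F : Finset ι) (r : ι → ℝ), Set.InjOn r F →
    {k : ℕ | ∀ u ∈ F, ∀ v ∈ F, r u < r v → pt u k < pt v k}.Infinite

/-- The finite set `f` of pairs of points and the finite set `K` of pairs of coordinates preserve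
the order of coordinates mod `δ`, and the other coordinates are small. -/
structure Matching (pt : ι → C₀(ℕ, ℝ)) (δ : ℝ) (f : Finset (ι × ι)) (K : Finset (ℕ × ℕ)) :
    Prop where
  inj : ∀ c ∈ K, ∀ d ∈ K, c.1 = d.1 ↔ c.2 = d.2
  order : ∀ c ∈ K, ∀ p ∈ f, ∀ q ∈ f, ∀ m : ℤ,
    pt p.1 c.1 < pt q.1 c.1 + m * δ ↔ pt p.2 c.2 < pt q.2 c.2 + m * δ
  left : ∀ k, (∀ c ∈ K, c.1 ≠ k) → ∀ p ∈ f, |pt p.1 k| < δ / 2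
  right : ∀ k, (∀ c ∈ K, c.2 ≠ k) → ∀ p ∈ f, |pt p.2 k| < δ / 2

/-- A finite set of pairs is an isomorphism between finite induced subgraphs. -/
structure IsFinitePartialIso (G H : SimpleGraph ι) (f : Finset (ι × ι)) : Prop where
  inj : ∀ p ∈ f, ∀ q ∈ f, p.1 = q.1 ↔ p.2 = q.2
  adj : ∀ p ∈ f, ∀ q ∈ f, G.Adj p.1 q.1 ↔ H.Adj p.2 q.2

lemma IsFinitePartialIso.swap [DecidableEq ι] {G H : SimpleGraph ι} {f : Finset (ι × ι)}
    (h : IsFinitePartialIso G H f) : IsFinitePartialIso H G (f.image Prod.swap) where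
  inj := by
    simp only [Finset.forall_mem_image]
    exact fun p hp q hq => (h.inj p hp q hq).symm
  adj := by
    simp only [Finset.forall_mem_image]
    exact fun p hp q hq => (h.adj p hp q hq).symm

namespace Matching

variable {pt : ι → C₀(ℕ, ℝ)} {δ : ℝ} {f : Finset (ι × ι)} {K : Finset (ℕ × ℕ)}

lemma swap [DecidableEq ι] (h : Matching pt δ f K) :
    Matching pt δ (f.image Prod.swap) (K.image Prod.swap) where
  inj := by
    simp only [Finset.forall_mem_image]
    exact fun p hp q hq => (h.inj p hp q hq).symm
  order := by
    simp only [Finset.forall_mem_image]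
    exact fun c hc p hp q hq m => (h.order c hc p hp q hq m).symm
  left := by
    simp only [Finset.forall_mem_image]
    exact h.right
  right := by
    simp only [Finset.forall_mem_image]
    exact h.left

/-- A further coordinate can be matched. -/
lemma exists_coord (h : Matching pt δ f K) (ho : HasAllOrders pt)
    (hf : ∀ p ∈ f, ∀ q ∈ f, p.1 = q.1 ↔ p.2 = q.2)
    (hne : ∀ u v, u ≠ v → ∀ k, pt u k ≠ pt v k) (k : ℕ) :
    ∃ K', K ⊆ K' ∧ Matching pt δ f K' ∧ ∃ c ∈ K', c.1 = k := by
  classical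
  by_cases hk : ∃ c ∈ K, c.1 = k
  · exact ⟨K, subset_rfl, h, hk⟩
  push Not at hk
  -- `r` carries the `k`-th coordinates of the sources over to their images; the value 0 elsewhere
  -- is never used.
  have hr : ∀ u, ∃ r : ℝ, ∀ p ∈ f, p.2 = u → r = pt p.1 k := by
    intro u
    by_cases hu : ∃ p ∈ f, p.2 = u
    · obtain ⟨p, hp, rfl⟩ := hu
      exact ⟨pt p.1 k, fun q hq hqp => by rw [(hf q hq p hp).2 hqp]⟩
    · exact ⟨0, fun p hp hpu => (hu ⟨p, hp, hpu⟩).elim⟩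
  choose r hr using hr
  -- Infinitely many coordinates show this order, so one is still unmatched.
  obtain ⟨k', hk', hk'K⟩ := (ho (f.image Prod.snd) r (by
    intro u hu v hv huv
    simp only [Finset.coe_image, Set.mem_image, Finset.mem_coe] at hu hv
    obtain ⟨p, hp, rfl⟩ := hu
    obtain ⟨q, hq, rfl⟩ := hv
    rw [hr _ p hp rfl, hr _ q hq rfl] at huv
    refine (hf p hp q hq).1 ?_
    by_contra hpq
    exact hne _ _ hpq k huv)).exists_notMem_finset (K.image Prod.snd)
  have hk'K' : ∀ c ∈ K, c.2 ≠ k' := fun c hc hck =>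
    hk'K (hck ▸ Finset.mem_image_of_mem Prod.snd hc)
  have hlt : ∀ p ∈ f, ∀ q ∈ f, pt p.1 k < pt q.1 k → pt p.2 k' < pt q.2 k' := by
    intro p hp q hq hpq
    refine hk' _ (Finset.mem_image_of_mem _ hp) _ (Finset.mem_image_of_mem _ hq) ?_
    rwa [hr _ p hp rfl, hr _ q hq rfl]
  have hord : ∀ p ∈ f, ∀ q ∈ f, pt p.1 k < pt q.1 k ↔ pt p.2 k' < pt q.2 k' := by
    intro p hp q hq
    refine ⟨hlt p hp q hq, fun h2 => ?_⟩
    rcases lt_trichotomy (pt p.1 k) (pt q.1 k) with h3 | h3 | h3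
    · exact h3
    · have hpq : p.1 = q.1 := by
        by_contra hpq
        exact hne _ _ hpq k h3
      rw [(hf p hp q hq).1 hpq] at h2
      exact (lt_irrefl _ h2).elim
    · exact (lt_asymm h2 (hlt q hq p hp h3)).elim
  refine ⟨insert (k, k') K, Finset.subset_insert _ _, ⟨?_, ?_, ?_, ?_⟩,
    (k, k'), Finset.mem_insert_self _ _, rfl⟩
  · simp only [Finset.forall_mem_insert, iff_self, true_and]
    refine ⟨fun d hd => iff_of_false (hk d hd).symm (hk'K' d hd).symm, fun c hc =>
      ⟨iff_of_false (hk c hc) (hk'K' c hc), h.inj c hc⟩⟩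
  · simp only [Finset.forall_mem_insert]
    refine ⟨fun p hp q hq m => ?_, h.order⟩
    exact lt_add_mul_iff_of_abs_lt (h.left k hk p hp) (h.left k hk q hq) (h.right k' hk'K' p hp)
      (h.right k' hk'K' q hq) (hord p hp q hq) m
  · exact fun l hl => h.left l fun c hc => hl c (Finset.mem_insert_of_mem hc)
  · exact fun l hl => h.right l fun c hc => hl c (Finset.mem_insert_of_mem hc)

/-- Finitely many further coordinates can be matched. -/
lemma exists_coords (h : Matching pt δ f K) (ho : HasAllOrders pt)
    (hf : ∀ p ∈ f, ∀ q ∈ f, p.1 = q.1 ↔ p.2 = q.2)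
    (hne : ∀ u v, u ≠ v → ∀ k, pt u k ≠ pt v k) (S : Finset ℕ) :
    ∃ K', K ⊆ K' ∧ Matching pt δ f K' ∧ ∀ k ∈ S, ∃ c ∈ K', c.1 = k := by
  classical
  induction S using Finset.induction_on with
  | empty => exact ⟨K, subset_rfl, h, by simp⟩
  | insert k S _ ih =>
    obtain ⟨K₁, hK₁, h₁, hS⟩ := ih
    obtain ⟨K₂, hK₂, h₂, hk⟩ := h₁.exists_coord ho hf hne k
    refine ⟨K₂, hK₁.trans hK₂, h₂, Finset.forall_mem_insert _ _ _ |>.2 ⟨hk, fun l hl => ?_⟩⟩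
    obtain ⟨c, hc, hcl⟩ := hS l hl
    exact ⟨c, hK₂ hc, hcl⟩

/-- A matching preserves the distance threshold `δ`. -/
lemma norm_sub_lt (h : Matching pt δ f K) (hδ : 0 < δ) {p q : ι × ι} (hp : p ∈ f) (hq : q ∈ f)
    (hpq : ‖pt p.1 - pt q.1‖ < δ) : ‖pt p.2 - pt q.2‖ < δ := by
  rw [norm_lt_iff_forall_abs_lt hδ] at hpq ⊢
  intro k
  rw [ZeroAtInftyContinuousMap.sub_apply, abs_lt]
  by_cases hk : ∃ c ∈ K, c.2 = k
  · obtain ⟨c, hc, rfl⟩ := hk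
    have h1 := hpq c.1
    rw [ZeroAtInftyContinuousMap.sub_apply, abs_lt] at h1
    -- The two inequalities with shift m = 1 together say that the difference is less than δ in
    -- absolute value.
    have h2 := (h.order c hc p hp q hq 1).1 (by push_cast; linarith)
    have h3 := (h.order c hc q hq p hp 1).1 (by push_cast; linarith)
    push_cast at h2 h3
    constructor <;> linarith
  · push Not at hk
    have h1 := abs_lt.1 (h.right k hk p hp)
    have h2 := abs_lt.1 (h.right k hk q hq)
    constructor <;> linarith [h1.1, h1.2, h2.1, h2.2]

/-- The images suitable for a further point contain a nonempty open set. -/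
lemma exists_isOpen_insert [DecidableEq ι] (h : Matching pt δ f K) (hδ : 0 < δ) {v : ι}
    (hv : ∀ k, (∀ c ∈ K, c.1 ≠ k) → |pt v k| < δ / 2)
    (hgen : ∀ p ∈ f, ∀ k, ∀ m : ℤ, pt v k ≠ pt p.1 k + m * δ) :
    ∃ U : Set C₀(ℕ, ℝ), IsOpen U ∧ U.Nonempty ∧
      ∀ w, pt w ∈ U → Matching pt δ (insert (v, w) f) K := by
  have key : ∀ c : ℕ × ℕ, ∃ O : Set ℝ, c ∈ K → IsOpen O ∧ O.Nonempty ∧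
      ∀ s ∈ O, ∀ p ∈ f, ∀ m : ℤ,
        (pt v c.1 < pt p.1 c.1 + m * δ ↔ s < pt p.2 c.2 + m * δ) ∧
        (pt p.1 c.1 < pt v c.1 + m * δ ↔ pt p.2 c.2 < s + m * δ) := by
    intro c
    by_cases hc : c ∈ K
    · obtain ⟨O, hO⟩ := exists_isOpen_same_order f (fun p => pt p.1 c.1) (fun p => pt p.2 c.2) hδ
        (h.order c hc) (pt v c.1) fun p hp m => hgen p hp c.1 m
      exact ⟨O, fun _ => hO⟩
    · exact ⟨∅, fun hc' => (hc hc').elim⟩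
  choose O hO using key
  have hs : ∀ c, ∃ s, c ∈ K → s ∈ O c := fun c => by
    by_cases hc : c ∈ K
    · exact ⟨_, fun _ => (hO c hc).2.1.some_mem⟩
    · exact ⟨0, fun hc' => (hc hc').elim⟩
  choose s hs using hs
  -- Admissible values at the matched coordinates and zero elsewhere; injectivity of `K` keeps the
  -- summands from colliding.
  let w₀ : C₀(ℕ, ℝ) := ofFinsupp (∑ c ∈ K, Finsupp.single c.2 (s c))
  have hw₀ : ∀ c ∈ K, w₀ c.2 = s c := by
    intro c hc
    rw [ofFinsupp_apply, Finsupp.finsetSum_apply, Finset.sum_eq_single_of_mem c hc]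
    · simp
    · intro d hd hdc
      refine Finsupp.single_eq_of_ne fun hcd => hdc ?_
      exact Prod.ext ((h.inj d hd c hc).2 hcd.symm) hcd.symm
  have hw₀' : ∀ k, (∀ c ∈ K, c.2 ≠ k) → w₀ k = 0 := by
    intro k hk
    rw [ofFinsupp_apply, Finsupp.finsetSum_apply]
    exact Finset.sum_eq_zero fun c hc => Finsupp.single_eq_of_ne (hk c hc).symm
  refine ⟨(⋂ c ∈ K, {w : C₀(ℕ, ℝ) | w c.2 ∈ O c}) ∩ Metric.ball w₀ (δ / 2),
    (isOpen_biInter_finset fun c hc => (hO c hc).1.preimage (continuous_eval_coord c.2)).inter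
      Metric.isOpen_ball, ⟨w₀, Set.mem_iInter₂.2 fun c hc => ?_,
        Metric.mem_ball_self (half_pos hδ)⟩, ?_⟩
  · rw [Set.mem_ofPred_eq, hw₀ c hc]
    exact hs c hc
  rintro w ⟨hw1, hw2⟩
  have hwO : ∀ c ∈ K, pt w c.2 ∈ O c := fun c hc => Set.mem_iInter₂.1 hw1 c hc
  refine ⟨h.inj, ?_, ?_, ?_⟩
  · intro c hc
    simp only [Finset.forall_mem_insert]
    refine ⟨⟨fun m => ?_, fun q hq m => ((hO c hc).2.2 _ (hwO c hc) q hq m).1⟩, fun p hp =>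
      ⟨fun m => ((hO c hc).2.2 _ (hwO c hc) p hp m).2, h.order c hc p hp⟩⟩
    simp
  · intro k hk
    rw [Finset.forall_mem_insert]
    exact ⟨hv k hk, h.left k hk⟩
  · intro k hk
    rw [Finset.forall_mem_insert]
    refine ⟨?_, h.right k hk⟩
    rw [mem_ball_iff_norm] at hw2
    have := (norm_lt_iff_forall_abs_lt (half_pos hδ) _).1 hw2 k
    rwa [ZeroAtInftyContinuousMap.sub_apply, hw₀' k hk, sub_zero] at this

end Matching

/-- One step forth. Matching the large coordinates of `v` leaves an open set of candidates, all of
them within δ of the images of the neighbours of `v`, which is exactly what local extensibility of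
`H` requires. -/
lemma exists_extension [DecidableEq ι] {pt : ι → C₀(ℕ, ℝ)} {δ : ℝ} (hδ : 0 < δ)
    (ho : HasAllOrders pt) (hne : ∀ u v, u ≠ v → ∀ k, pt u k ≠ pt v k)
    {G H : SimpleGraph ι} (hG : ∀ u v, G.Adj u v → ‖pt u - pt v‖ < δ)
    (hH : IsLocallyExtensible pt δ H)
    {f : Finset (ι × ι)} {K : Finset (ℕ × ℕ)} (hf : IsFinitePartialIso G H f)
    (hK : Matching pt δ f K) {v : ι} (hv : ∀ p ∈ f, p.1 ≠ v)
    (hgen : ∀ p ∈ f, ∀ k, ∀ m : ℤ, pt v k ≠ pt p.1 k + m * δ) :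
    ∃ w K', IsFinitePartialIso G H (insert (v, w) f) ∧ Matching pt δ (insert (v, w) f) K' := by
  classical
  obtain ⟨K', -, hK', hS⟩ := hK.exists_coords ho hf.inj hne
    (finite_setOf_le_abs (half_pos hδ) (pt v)).toFinset
  obtain ⟨U, hUo, hUn, hU⟩ := hK'.exists_isOpen_insert hδ (v := v) (fun k hk => by
    by_contra hlt
    obtain ⟨c, hc, hck⟩ := hS k (by simpa using hlt)
    exact hk c hc hck) hgen
  obtain ⟨w, hwU, hwA, hwB, hA, hB⟩ := hH U hUo hUn
    ((f.filter fun p => G.Adj v p.1).image Prod.snd)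
    ((f.filter fun p => ¬ G.Adj v p.1).image Prod.snd) (by
      rw [Finset.disjoint_left]
      simp only [Finset.mem_image, Finset.mem_filter]
      rintro _ ⟨p, ⟨hp, hpv⟩, rfl⟩ ⟨q, ⟨hq, hqv⟩, hqp⟩
      rw [(hf.inj q hq p hp).2 hqp] at hqv
      exact hqv hpv) (by
      simp only [Finset.forall_mem_image, Finset.mem_filter]
      rintro p ⟨hp, hpv⟩ w hw
      exact (hU w hw).norm_sub_lt hδ (p := (v, w)) (q := p) (Finset.mem_insert_self _ _)
        (Finset.mem_insert_of_mem hp) (hG _ _ hpv))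
  have hw : ∀ p ∈ f, p.2 ≠ w := by
    rintro p hp rfl
    by_cases hpv : G.Adj v p.1
    · exact hwA (Finset.mem_image_of_mem _ (Finset.mem_filter.2 ⟨hp, hpv⟩))
    · exact hwB (Finset.mem_image_of_mem _ (Finset.mem_filter.2 ⟨hp, hpv⟩))
  have hadj : ∀ p ∈ f, G.Adj v p.1 ↔ H.Adj w p.2 := fun p hp => by
    by_cases hpv : G.Adj v p.1
    · exact iff_of_true hpv
        (hA _ (Finset.mem_image_of_mem _ (Finset.mem_filter.2 ⟨hp, hpv⟩)))
    · exact iff_of_false hpv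
        (hB _ (Finset.mem_image_of_mem _ (Finset.mem_filter.2 ⟨hp, hpv⟩)))
  refine ⟨w, K', ⟨?_, ?_⟩, hU w hwU⟩
  · simp only [Finset.forall_mem_insert, true_and]
    exact ⟨fun q hq => iff_of_false (hv q hq).symm (hw q hq).symm, fun p hp =>
      ⟨iff_of_false (hv p hp) (hw p hp), hf.inj p hp⟩⟩
  · simp only [Finset.forall_mem_insert, SimpleGraph.irrefl, true_and]
    exact ⟨hadj, fun p hp => ⟨by rw [G.adj_comm, H.adj_comm]; exact hadj p hp, hf.adj p hp⟩⟩

/-- Two locally extensible graphs of near pairs are isomorphic, provided the pairs of points with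
coordinates congruent mod `δ` involve only a finite set of pairwise far points. -/
theorem nonempty_iso_of_isLocallyExtensible [Countable ι] {pt : ι → C₀(ℕ, ℝ)} {δ : ℝ}
    (hδ : 0 < δ) (ho : HasAllOrders pt) (hne : ∀ u v, u ≠ v → ∀ k, pt u k ≠ pt v k)
    (S : Finset ι) (hS : ∀ u ∈ S, ∀ v ∈ S, ¬ ‖pt u - pt v‖ < δ ∨ u = v)
    (hgen : ∀ u v, u ≠ v → ∀ k, ∀ m : ℤ, pt u k = pt v k + m * δ → u ∈ S)
    {G H : SimpleGraph ι} (hG : ∀ u v, G.Adj u v → ‖pt u - pt v‖ < δ)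
    (hH : ∀ u v, H.Adj u v → ‖pt u - pt v‖ < δ)
    (hGe : IsLocallyExtensible pt δ G) (hHe : IsLocallyExtensible pt δ H) :
    Nonempty (G ≃g H) := by
  classical
  have forth : ∀ (G H : SimpleGraph ι), (∀ u v, G.Adj u v → ‖pt u - pt v‖ < δ) →
      IsLocallyExtensible pt δ H → ∀ f : Finset (ι × ι), (IsFinitePartialIso G H f ∧
        (∀ b ∈ S, (b, b) ∈ f) ∧ ∃ K, Matching pt δ f K) → ∀ v, ∃ g,
      (IsFinitePartialIso G H g ∧ (∀ b ∈ S, (b, b) ∈ g) ∧ ∃ K, Matching pt δ g K) ∧ f ⊆ g ∧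
        ∃ w, (v, w) ∈ g := by
    rintro G H hG hH f ⟨hf, hfS, K, hK⟩ v
    by_cases hv : ∃ p ∈ f, p.1 = v
    · obtain ⟨p, hp, rfl⟩ := hv
      exact ⟨f, ⟨hf, hfS, K, hK⟩, subset_rfl, p.2, hp⟩
    push Not at hv
    obtain ⟨w, K', h1, h2⟩ := exists_extension hδ ho hne hG hH hf hK hv
      fun p hp k m hm => hv (v, v) (hfS v (hgen v p.1 (hv p hp).symm k m hm)) rfl
    exact ⟨_, ⟨h1, fun b hb => Finset.mem_insert_of_mem (hfS b hb), K', h2⟩,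
      Finset.subset_insert _ _, w, Finset.mem_insert_self _ _⟩
  have swap_swap : ∀ f : Finset (ι × ι), (f.image Prod.swap).image Prod.swap = f := fun f => by
    rw [Finset.image_image, Prod.swap_swap_eq, Finset.image_id]
  have init : IsFinitePartialIso G H (S.image fun b => (b, b)) ∧
      (∀ b ∈ S, (b, b) ∈ S.image fun b => (b, b)) ∧
      ∃ K, Matching pt δ (S.image fun b => (b, b)) K := by
    refine ⟨⟨?_, ?_⟩, fun b hb => Finset.mem_image_of_mem _ hb, ?_⟩
    · simp
    · simp only [Finset.forall_mem_image]
      intro a ha b hb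
      rcases hS a ha b hb with h | rfl
      -- Distinct points of `S` are far apart, hence nonadjacent in both graphs, so the identity on
      -- `S` is a partial isomorphism.
      · exact iff_of_false (fun h' => h (hG _ _ h')) (fun h' => h (hH _ _ h'))
      · simp
    · refine ⟨(S.biUnion fun b => (finite_setOf_le_abs (half_pos hδ) (pt b)).toFinset).image
        fun k => (k, k), ?_, ?_, ?_, ?_⟩
      · simp only [Finset.forall_mem_image, implies_true]
      · simp only [Finset.forall_mem_image, implies_true]
      all_goals
        simp only [Finset.forall_mem_image]
        intro k hk b hb
        by_contra hlt
        refine hk (Finset.mem_biUnion.2 ⟨b, hb, ?_⟩) rfl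
        simpa using hlt
  obtain ⟨e, he⟩ := exists_equiv_of_back_and_forth
    (fun f => IsFinitePartialIso G H f ∧ (∀ b ∈ S, (b, b) ∈ f) ∧ ∃ K, Matching pt δ f K)
    (S.image fun b => (b, b)) init (fun f hf => hf.1.inj) (forth G H hG hHe) (by
      rintro f ⟨hf, hfS, K, hK⟩ b
      obtain ⟨g, ⟨hg, hgS, K', hK'⟩, hfg, a, ha⟩ := forth H G hH hGe (f.image Prod.swap)
        ⟨hf.swap, fun b hb => Finset.mem_image_of_mem Prod.swap (hfS b hb), _, hK.swap⟩ b
      refine ⟨g.image Prod.swap, ⟨hg.swap, fun b hb =>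
        Finset.mem_image_of_mem Prod.swap (hgS b hb), _, hK'.swap⟩, ?_, a,
        Finset.mem_image_of_mem Prod.swap ha⟩
      rw [← swap_swap f]
      exact Finset.image_subset_image hfg)
  refine ⟨⟨e, ?_⟩⟩
  intro a a'
  obtain ⟨f, hf, h1, h2⟩ := he a a'
  exact (hf.1.adj _ h1 _ h2).symm


/-! ### Borel-Cantelli and random orders -/

/-- Independent random variables, one with an atomless law, almost surely differ. -/
lemma ae_ne_of_indepFun {Ω : Type*} {mΩ : MeasurableSpace Ω} {P : Measure Ω}
    [IsProbabilityMeasure P] {X Y : Ω → ℝ} (hX : Measurable X) (hY : Measurable Y)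
    (h : IndepFun X Y P) [NullSingletonClass (P.map X)] : ∀ᵐ ω ∂P, X ω ≠ Y ω := by
  have : IsProbabilityMeasure (P.map X) := Measure.isProbabilityMeasure_map hX.aemeasurable
  have : IsProbabilityMeasure (P.map Y) := Measure.isProbabilityMeasure_map hY.aemeasurable
  have hD : MeasurableSet {p : ℝ × ℝ | p.1 = p.2} :=
    measurableSet_eq_fun measurable_fst measurable_snd
  have h0 : (P.map fun ω => (Y ω, X ω)) {p : ℝ × ℝ | p.1 = p.2} = 0 := by
    rw [(indepFun_iff_map_prod_eq_prod_map_map hY.aemeasurable hX.aemeasurable).1 h.symm,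
      Measure.measure_prod_null hD]
    refine Eventually.of_forall fun y => ?_
    have : Prod.mk y ⁻¹' {p : ℝ × ℝ | p.1 = p.2} = {y} := by ext z; simp [eq_comm]
    simp [this]
  rw [Measure.map_apply (hY.prodMk hX) hD] at h0
  rw [ae_iff]
  simpa [eq_comm] using h0

/-- The second Borel-Cantelli lemma for boxes on disjoint finite sets of coordinates. -/
lemma ae_frequently_mem_boxes {ι : Type*} {X : ι → Type*} {mX : ∀ i, MeasurableSpace (X i)}
    (P : ∀ i, Measure (X i)) [∀ i, IsProbabilityMeasure (P i)] (S : ∀ i, Set (X i))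
    (hS : ∀ i, MeasurableSet (S i)) (T : ℕ → Finset ι)
    (hT : ∀ m n, m ≠ n → Disjoint (T m) (T n)) (c : ℝ≥0∞) (hc : c ≠ 0)
    (hcT : ∀ n, c ≤ ∏ i ∈ T n, P i (S i)) :
    ∀ᵐ ω ∂(Measure.infinitePi P), ∃ᶠ n in atTop, ∀ i ∈ T n, ω i ∈ S i := by
  classical
  let E : ℕ → Set (∀ i, X i) := fun n => Set.pi (T n) S
  have hE : ∀ n, MeasurableSet (E n) := fun n => .pi (T n).countable_toSet fun i _ => hS i
  have hind : iIndepSet E (Measure.infinitePi P) := by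
    rw [iIndepSet_iff_meas_biInter hE]
    intro s
    have : ⋂ n ∈ s, E n = Set.pi (s.biUnion T) S := by
      ext ω
      simp only [E, Set.mem_iInter, Set.mem_pi, Finset.mem_coe, Finset.mem_biUnion]
      exact ⟨fun h i ⟨n, hn, hi⟩ => h n hn i hi, fun h n hn i hi => h i ⟨n, hn, hi⟩⟩
    rw [this, Measure.infinitePi_pi _ fun i _ => hS i,
      Finset.prod_biUnion fun m _ n _ hmn => hT m n hmn]
    exact Finset.prod_congr rfl fun n _ => (Measure.infinitePi_pi _ fun i _ => hS i).symm
  have h1 := measure_limsup_eq_one hE hind (by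
    refine top_unique ?_
    rw [← ENNReal.tsum_const_eq_top_of_ne_zero (α := ℕ) hc]
    refine ENNReal.tsum_le_tsum fun n => (hcT n).trans_eq ?_
    exact (Measure.infinitePi_pi _ fun i _ => hS i).symm)
  have h2 : ∀ᵐ ω ∂(Measure.infinitePi P), ω ∈ limsup E atTop :=
    (prob_compl_eq_zero_iff (MeasurableSet.measurableSet_limsup hE)).2 h1
  filter_upwards [h2] with ω hω
  rw [mem_limsup_iff_frequently_mem] at hω
  exact hω

/-- A given order of finitely many i.i.d. atomless random variables has positive probability. -/
lemma inv_factorial_le_infinitePi_strictMono (ν : Measure ℝ) [IsProbabilityMeasure ν]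
    [NullSingletonClass ν] {n : ℕ} {s : Fin n → ℕ} (hs : Function.Injective s) :
    ((n.factorial : ℝ≥0∞))⁻¹ ≤
      Measure.infinitePi (fun _ : ℕ => ν) {y | StrictMono fun i => y (s i)} := by
  let π := Measure.infinitePi fun _ : Fin n => ν
  have hM : MeasurableSet {z : Fin n → ℝ | StrictMono z} := by
    simp only [StrictMono, Set.ofPred_forall]
    exact .iInter fun i => .iInter fun j => .iInter fun _ =>
      measurableSet_lt (measurable_pi_apply i) (measurable_pi_apply j)
  have h1 : Measure.infinitePi (fun _ : ℕ => ν) {y | StrictMono fun i => y (s i)} =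
      π {z | StrictMono z} := by
    rw [show π = _ from (Measure.map_infinitePi_infinitePi_of_inj (P := fun _ : ℕ => ν) hs).symm,
      Measure.map_apply (by fun_prop) hM]
    rfl
  -- Exchangeability: all n! orders are equally likely, and almost surely one of them occurs.
  have h2 : ∀ σ : Equiv.Perm (Fin n), π {z | StrictMono (z ∘ σ)} = π {z | StrictMono z} := by
    intro σ
    conv_rhs => rw [show π = _ from
      (Measure.map_infinitePi_infinitePi_of_inj (P := fun _ : Fin n => ν) σ.injective).symm,
      Measure.map_apply (by fun_prop) hM]
    rfl
  have h3 : ∀ᵐ z ∂π, Function.Injective z := by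
    have : ∀ i j : Fin n, i ≠ j → ∀ᵐ z ∂π, z i ≠ z j := by
      intro i j hij
      have hN : NullSingletonClass (π.map fun z => z i) := by
        rw [Measure.infinitePi_map_eval]
        infer_instance
      exact ae_ne_of_indepFun (measurable_pi_apply i) (measurable_pi_apply j)
        ((iIndepFun_infinitePi (P := fun _ : Fin n => ν) (X := fun _ x => x)
          (fun _ => measurable_id)).indepFun hij)
    have h := ae_all_iff.2 fun i => ae_all_iff.2 fun j => ae_all_iff.2 (this i j)
    filter_upwards [h] with z hz i j hij
    by_contra hne
    exact hz i j hne hij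
  have h4 : π (⋃ σ : Equiv.Perm (Fin n), {z | StrictMono (z ∘ σ)}) = 1 := by
    rw [← measure_univ (μ := π)]
    refine measure_congr ?_
    filter_upwards [h3] with z hz
    refine eq_true (Set.mem_iUnion.2 ⟨Tuple.sort z, ?_⟩)
    exact (Tuple.monotone_sort z).strictMono_of_injective (hz.comp (Tuple.sort z).injective)
  rw [h1, ENNReal.inv_le_iff_le_mul (by simp) (by simp)]
  calc (1 : ℝ≥0∞) = π (⋃ σ : Equiv.Perm (Fin n), {z | StrictMono (z ∘ σ)}) := h4.symm
    _ ≤ ∑' σ : Equiv.Perm (Fin n), π {z | StrictMono (z ∘ σ)} := measure_iUnion_le _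
    _ = n.factorial * π {z | StrictMono z} := by
      simp only [h2, tsum_fintype, Finset.sum_const, Finset.card_univ, Fintype.card_perm,
        Fintype.card_fin, nsmul_eq_mul]

/-- Both sides are curryings of one product measure over ℕ × ℕ. This turns independent samples into
independent coordinates, to which Borel-Cantelli applies. -/
lemma infinitePi_map_transpose (ν : ℕ → Measure ℝ) [∀ n, IsProbabilityMeasure (ν n)] :
    (Measure.infinitePi fun _ : ℕ => Measure.infinitePi ν).map (fun x k i => x i k) =
      Measure.infinitePi fun k => Measure.infinitePi fun _ : ℕ => ν k := by
  have h1 := Measure.infinitePi_map_curry fun (k : ℕ) (_ : ℕ) => ν k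
  have h2 := Measure.map_infinitePi_infinitePi_of_inj (P := fun p : ℕ × ℕ => ν p.2)
    (f := Prod.swap) Prod.swap_injective
  have h3 := Measure.infinitePi_map_curry_symm fun (_ : ℕ) (k : ℕ) => ν k
  rw [← h3, Measure.map_map (by fun_prop) (by fun_prop)] at h2
  simp only [Prod.snd_swap] at h2
  rw [← h2, Measure.map_map (by fun_prop) (by fun_prop)] at h1
  exact h1

/-- Under i.i.d. sampling from a product of atomless measures, every order of finitely many samples
is realised by infinitely many coordinates. -/
lemma ae_infinite_strictMono (ν : ℕ → Measure ℝ) [∀ n, IsProbabilityMeasure (ν n)]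
    [∀ n, NullSingletonClass (ν n)] {n : ℕ} {s : Fin n → ℕ} (hs : Function.Injective s) :
    ∀ᵐ x ∂(Measure.infinitePi fun _ : ℕ => Measure.infinitePi ν),
      {k | StrictMono fun i => x (s i) k}.Infinite := by
  have hM : MeasurableSet {y : ℕ → ℝ | StrictMono fun i => y (s i)} := by
    simp only [StrictMono, Set.ofPred_forall]
    exact .iInter fun i => .iInter fun j => .iInter fun _ =>
      measurableSet_lt (measurable_pi_apply _) (measurable_pi_apply _)
  have h := ae_frequently_mem_boxes (fun k => Measure.infinitePi fun _ : ℕ => ν k)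
    (fun _ => {y | StrictMono fun i => y (s i)}) (fun _ => hM) (fun k => {k})
    (fun m n hmn => by simpa using hmn) ((n.factorial : ℝ≥0∞))⁻¹ (by simp) (fun k => by
      simpa using inv_factorial_le_infinitePi_strictMono (ν k) hs)
  rw [← infinitePi_map_transpose] at h
  filter_upwards [ae_of_ae_map (measurable_pi_iff.2 fun k => measurable_pi_iff.2 fun i =>
    (measurable_pi_apply k).comp (measurable_pi_apply i)).aemeasurable h] with x hx
  rw [← Nat.frequently_atTop_iff_infinite]
  simpa using hx


/-! ### Almost sure properties of the random graph -/

lemma measurableSet_adj {V : Type*} (u v : V) : MeasurableSet {G : SimpleGraph V | G.Adj u v} :=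
  measurableSet_setOfPred.2 (by fun_prop)

section Graph

variable {X : Type*} [NormedAddCommGroup X] {V : Set X}

/-- Exposes the independent coins, one for each unordered pair, behind the random graph. -/
lemma ae_LARG_of_ae_infinitePi {δ : ℝ} {p : unitInterval}
    {Q : SimpleGraph V → Prop} (hQ : MeasurableSet {G | Q G})
    (h : ∀ᵐ ω ∂(Measure.infinitePi fun e : Sym2 V =>
      unitInterval.toNNReal p • Measure.dirac (e ∈ (nearGraph V δ).edgeSet) +
        unitInterval.toNNReal (unitInterval.symm p) • Measure.dirac False),
      Q (SimpleGraph.fromEdgeSet {e | ω e})) : ∀ᵐ G ∂(LARG V δ p), Q G := by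
  rw [LARG, ae_map_iff SimpleGraph.measurable_fromEdgeSet.aemeasurable hQ,
    setBernoulli_eq_map]
  exact (MeasurableEquiv.setOfPred.measurableEmbedding.ae_map_iff).2 h

lemma ae_LARG_adj (hV : V.Countable) (δ : ℝ) (p : unitInterval) :
    ∀ᵐ G ∂(LARG V δ p), ∀ u v : V, G.Adj u v → ‖(u : X) - v‖ < δ := by
  have := hV.to_subtype
  rw [LARG, ae_map_iff SimpleGraph.measurable_fromEdgeSet.aemeasurable]
  · have : Countable (Sym2 V) := Sym2.mk_surjective.countable
    filter_upwards [setBernoulli_ae_subset (u := (nearGraph V δ).edgeSet) (p := p)] with s hs u v huv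
    have h : s(u, v) ∈ (nearGraph V δ).edgeSet := hs ((SimpleGraph.fromEdgeSet_adj s).1 huv).1
    exact h.2
  · simp only [Set.ofPred_forall]
    refine .iInter fun u => .iInter fun v => ?_
    by_cases h : ‖(u : X) - v‖ < δ
    · simp [h]
    · have : {G : SimpleGraph V | G.Adj u v → ‖(u : X) - v‖ < δ} = {G | G.Adj u v}ᶜ := by
        ext G
        simp [h]
      rw [this]
      exact (measurableSet_adj u v).compl

instance (δ : ℝ) (p : unitInterval) : IsProbabilityMeasure (LARG V δ p) :=
  Measure.isProbabilityMeasure_map SimpleGraph.measurable_fromEdgeSet.aemeasurable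

/-- Almost surely, a given open set contains a vertex of `LARG(V, δ, p)` with a prescribed
neighbourhood within a finite set. -/
lemma ae_LARG_exists_vertex [NormedSpace ℝ X] [Nontrivial X] (hV : V.Countable) (hd : Dense V)
    {δ : ℝ} {p : unitInterval} (hp0 : 0 < p) (hp1 : p < 1) {U : Set X} (hU : IsOpen U)
    (hUn : U.Nonempty) {A B : Finset V} (hAB : Disjoint A B)
    (hA : ∀ a ∈ A, ∀ w : V, (w : X) ∈ U → ‖(w : X) - a‖ < δ) :
    ∀ᵐ G ∂(LARG V δ p), ∃ w : V, (w : X) ∈ U ∧ w ∉ A ∧ w ∉ B ∧ (∀ a ∈ A, G.Adj w a) ∧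
      ∀ b ∈ B, ¬ G.Adj w b := by
  classical
  have := hV.to_subtype
  -- There are no isolated points, so a dense set stays dense after finitely many points are
  -- removed.
  have hinf : {w : V | (w : X) ∈ U ∧ w ∉ A ∧ w ∉ B}.Infinite := by
    intro hfin
    have hd' := (hd.sdiff_finite (hfin.image Subtype.val)).sdiff_finite
      ((A ∪ B).finite_toSet.image Subtype.val)
    obtain ⟨y, hyU, ⟨hyV, hy1⟩, hy2⟩ := hd'.inter_open_nonempty U hU hUn
    have hyAB : (⟨y, hyV⟩ : V) ∉ A ∪ B := fun h => hy2 ⟨_, h, rfl⟩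
    rw [Finset.mem_union, not_or] at hyAB
    exact hy1 ⟨⟨y, hyV⟩, ⟨hyU, hyAB⟩, rfl⟩
  let w : ℕ ↪ {w : V | (w : X) ∈ U ∧ w ∉ A ∧ w ∉ B} := hinf.natEmbedding
  let S : Sym2 V → Set Prop := fun e => if ∃ a ∈ A, a ∈ e then {True} else {False}
  let q : ℝ≥0∞ := min (unitInterval.toNNReal p) (unitInterval.toNNReal (unitInterval.symm p))
  have hq0 : q ≠ 0 := by
    have h1 : 0 < unitInterval.toNNReal p := hp0
    have h2 : 0 < unitInterval.toNNReal (unitInterval.symm p) := by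
      have : (p : ℝ) < 1 := hp1
      rw [← NNReal.coe_pos]
      simpa using hp1
    simp [q, h1.ne', h2.ne']
  have hq1 : q ≤ 1 := (min_le_left _ _).trans (by
    have : unitInterval.toNNReal p ≤ 1 := p.2.2
    exact_mod_cast this)
  have hbox := ae_frequently_mem_boxes (fun e : Sym2 V =>
      unitInterval.toNNReal p • Measure.dirac (e ∈ (nearGraph V δ).edgeSet) +
        unitInterval.toNNReal (unitInterval.symm p) • Measure.dirac False) S
    (fun _ => .of_discrete) (fun n => (A ∪ B).image fun a => s((w n : V), a)) (by
      intro m n hmn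
      rw [Finset.disjoint_left]
      simp only [Finset.mem_image]
      rintro _ ⟨a, ha, rfl⟩ ⟨b, hb, hab⟩
      rcases Sym2.eq_iff.1 hab with ⟨h1, -⟩ | ⟨h1, -⟩
      · exact hmn (w.injective (Subtype.ext h1)).symm
      · rw [← h1] at ha
        have := (w n).2.2
        rw [Finset.mem_union] at ha
        tauto) (q ^ (A ∪ B).card) (pow_ne_zero _ hq0) (by
      intro n
      calc q ^ (A ∪ B).card ≤ q ^ ((A ∪ B).image fun a => s((w n : V), a)).card :=
            pow_le_pow_right_of_le_one' hq1 Finset.card_image_le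
        _ ≤ _ := by
            rw [← Finset.prod_const]
            refine Finset.prod_le_prod' fun e he => ?_
            obtain ⟨b, hb, rfl⟩ := Finset.mem_image.1 he
            by_cases h : ∃ a ∈ A, a ∈ s((w n : V), b)
            · have hbA : b ∈ A := by
                obtain ⟨a, ha, hab⟩ := h
                rcases Sym2.mem_iff.1 hab with rfl | rfl
                · exact ((w n).2.2.1 ha).elim
                · exact ha
              -- Only pairs that must be edges need to be near; a non-edge has probability at least
              -- 1 - p in any case.
              have hmem : s((w n : V), b) ∈ (nearGraph V δ).edgeSet :=
                ⟨fun hwb : (w n : V) = b => (w n).2.2.1 (hwb ▸ hbA), hA b hbA _ (w n).2.1⟩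
              simp only [S, if_pos h, hmem]
              simp [q]
            · simp only [S, if_neg h]
              simp [q])
  refine ae_LARG_of_ae_infinitePi ?_ ?_
  · simp only [Set.ofPred_exists, Set.ofPred_and]
    refine .iUnion fun w => .inter (.const _) (.inter (.const _) (.inter (.const _) (.inter ?_ ?_)))
    · simp only [Set.ofPred_forall]
      exact .iInter fun a => .iInter fun _ => measurableSet_adj _ _
    · have : {G : SimpleGraph V | ∀ b ∈ B, ¬ G.Adj w b} = ⋂ b ∈ B, {G | G.Adj w b}ᶜ := by
        ext G
        simp
      rw [this]
      exact .iInter fun b => .iInter fun _ => (measurableSet_adj _ _).compl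
  · filter_upwards [hbox] with ω hω
    obtain ⟨n, hn⟩ := hω.exists
    refine ⟨w n, (w n).2.1, (w n).2.2.1, (w n).2.2.2, fun a ha => ?_, fun b hb => ?_⟩
    · have h := hn s((w n : V), a) (Finset.mem_image_of_mem _ (Finset.mem_union_left _ ha))
      simp only [S, if_pos (⟨a, ha, Sym2.mem_mk_right _ _⟩ : ∃ a' ∈ A, a' ∈ s((w n : V), a))] at h
      rw [SimpleGraph.fromEdgeSet_adj]
      exact ⟨of_eq_true h, fun hwa => (w n).2.2.1 (hwa ▸ ha)⟩
    · have h := hn s((w n : V), b) (Finset.mem_image_of_mem _ (Finset.mem_union_right _ hb))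
      have hne : ¬ ∃ a ∈ A, a ∈ s((w n : V), b) := by
        rintro ⟨a, ha, hab⟩
        rcases Sym2.mem_iff.1 hab with rfl | rfl
        · exact (w n).2.2.1 ha
        · exact Finset.disjoint_left.1 hAB ha hb
      simp only [S, if_neg hne] at h
      rw [SimpleGraph.fromEdgeSet_adj]
      exact fun h' => of_eq_false h h'.1

end Graph

instance : Nontrivial C₀(ℕ, ℝ) :=
  ⟨⟨ofFinsupp (Finsupp.single 0 1), 0, fun h => by simpa using DFunLike.congr_fun h 0⟩⟩

/-- Balls of radius 1/(n+1) around points of `V` form a base, so countably many almost sure events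
suffice. -/
lemma ae_LARG_isLocallyExtensible {V : Set C₀(ℕ, ℝ)} (hV : V.Countable) (hd : Dense V) {δ : ℝ}
    {p : unitInterval} (hp0 : 0 < p) (hp1 : p < 1) :
    ∀ᵐ G ∂(LARG V δ p), IsLocallyExtensible (Subtype.val : V → C₀(ℕ, ℝ)) δ G := by
  have := hV.to_subtype
  have h : ∀ᵐ G ∂(LARG V δ p), ∀ (v : V) (n : ℕ) (A B : Finset V), Disjoint A B →
      (∀ a ∈ A, ∀ w : V, (w : C₀(ℕ, ℝ)) ∈ Metric.ball (v : C₀(ℕ, ℝ)) (1 / (n + 1)) →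
        ‖(w : C₀(ℕ, ℝ)) - a‖ < δ) →
      ∃ w : V, (w : C₀(ℕ, ℝ)) ∈ Metric.ball (v : C₀(ℕ, ℝ)) (1 / (n + 1)) ∧ w ∉ A ∧ w ∉ B ∧
        (∀ a ∈ A, G.Adj w a) ∧ ∀ b ∈ B, ¬ G.Adj w b := by
    simp only [ae_all_iff]
    exact fun v n A B hAB hA => ae_LARG_exists_vertex hV hd hp0 hp1 Metric.isOpen_ball
      ⟨_, Metric.mem_ball_self Nat.one_div_pos_of_nat⟩ hAB hA
  filter_upwards [h] with G hG U hU hUn A B hAB hA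
  obtain ⟨v, hvU, hvV⟩ := hd.inter_open_nonempty U hU hUn
  obtain ⟨ε, hε, hεU⟩ := Metric.isOpen_iff.1 hU v hvU
  obtain ⟨n, hn⟩ := exists_nat_one_div_lt hε
  have hsub := (Metric.ball_subset_ball hn.le).trans hεU
  obtain ⟨w, hwU, hw⟩ := hG ⟨v, hvV⟩ n A B hAB fun a ha w hw => hA a ha w (hsub hw)
  exact ⟨w, hsub hwU, hw⟩


/-! ### Generic sequences -/

/-- No coordinate of a point of the sequence is a rational combination, of the given form, of
coordinates of other points. -/
def IsGeneric (x : ℕ → C₀(ℕ, ℝ)) : Prop :=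
  ∀ (i j i' j' k k' : ℕ) (q : ℚ), i ≠ j → i ≠ i' → i ≠ j' →
    x i k ≠ x j k + q * (x i' k' - x j' k')

lemma IsGeneric.apply_ne {x : ℕ → C₀(ℕ, ℝ)} (hx : IsGeneric x) {i j : ℕ} (hij : i ≠ j) (k : ℕ) :
    x i k ≠ x j k := by
  simpa using hx i j j j k k 0 hij hij hij

/-- One congruence between `x i` and `x j` with shift mδ, m ≠ 0, expresses δ rationally through
their coordinates. Substituting this into a congruence of any third point would contradict
genericity. The shift also makes `x i` and `x j` at least δ apart. -/
lemma IsGeneric.exists_finset {x : ℕ → C₀(ℕ, ℝ)} (hx : IsGeneric x) {δ : ℝ} (hδ : 0 < δ) :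
    ∃ S : Finset ℕ, (∀ i ∈ S, ∀ j ∈ S, ¬ ‖x i - x j‖ < δ ∨ i = j) ∧
      ∀ i j, i ≠ j → ∀ k, ∀ m : ℤ, x i k = x j k + m * δ → i ∈ S := by
  classical
  by_cases h : ∃ i j, i ≠ j ∧ ∃ k, ∃ m : ℤ, x i k = x j k + m * δ
  · obtain ⟨i, j, hij, k, m, hm⟩ := h
    have hm0 : m ≠ 0 := by
      rintro rfl
      exact hx.apply_ne hij k (by simpa using hm)
    have hfar : ¬ ‖x i - x j‖ < δ := by
      rw [norm_lt_iff_forall_abs_lt hδ]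
      push Not
      refine ⟨k, ?_⟩
      rw [ZeroAtInftyContinuousMap.sub_apply, hm, add_sub_cancel_left, abs_mul, abs_of_pos hδ]
      refine le_mul_of_one_le_left hδ.le ?_
      exact_mod_cast Int.one_le_abs hm0
    refine ⟨{i, j}, ?_, ?_⟩
    · have hfar' : ¬ ‖x j - x i‖ < δ := by rwa [norm_sub_rev]
      simp [not_lt.1 hfar, not_lt.1 hfar']
    · intro i' j' hij' k' m' hm'
      by_contra hi'
      simp only [Finset.mem_insert, Finset.mem_singleton, not_or] at hi'
      refine hx i' j' i j k' k (m' / m) hij' hi'.1 hi'.2 ?_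
      have : (m : ℝ) ≠ 0 := by exact_mod_cast hm0
      rw [hm', hm]
      push_cast
      field_simp
      ring
  · push Not at h
    exact ⟨∅, by simp, fun i j hij k m hm => (h i j hij k m hm).elim⟩

lemma hasAllOrders_of_strictMono {x : ℕ → C₀(ℕ, ℝ)}
    (hx : ∀ (n : ℕ) (s : Fin n → ℕ), Function.Injective s →
      {k | StrictMono fun i => x (s i) k}.Infinite) :
    HasAllOrders (Subtype.val : Set.range x → C₀(ℕ, ℝ)) := by
  classical
  intro F r hr
  let e := (F.image r).orderEmbOfFin rfl
  have he : ∀ i, ∃ j, ∃ u ∈ F, x j = u ∧ r u = e i := fun i => by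
    obtain ⟨u, hu, hui⟩ := Finset.mem_image.1 ((F.image r).orderEmbOfFin_mem rfl i)
    obtain ⟨j, hj⟩ := u.2
    exact ⟨j, u, hu, hj, hui⟩
  choose s u huF hsu hru using he
  have hs : Function.Injective s := fun i j hij => by
    refine e.injective ?_
    rw [← hru, ← hru, Subtype.ext (a1 := u i) (a2 := u j) (by rw [← hsu, ← hsu, hij])]
  refine (hx _ s hs).mono fun k hk v hv w hw hvw => ?_
  have hF : ∀ v ∈ F, ∃ i, v = u i := fun v hv => by
    have : r v ∈ Set.range e := by
      rw [Finset.range_orderEmbOfFin]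
      exact Finset.mem_image_of_mem r hv
    obtain ⟨i, hi⟩ := this
    exact ⟨i, hr hv (huF i) (by rw [hru, hi])⟩
  obtain ⟨i, rfl⟩ := hF v hv
  obtain ⟨j, rfl⟩ := hF w hw
  rw [hru, hru, e.lt_iff_lt] at hvw
  have := hk hvw
  simpa [hsu] using this

/-- A dense generic sequence in which all orders occur enumerates a Rado set. -/
theorem isRado_range {x : ℕ → C₀(ℕ, ℝ)} (hd : Dense (Set.range x)) (hx : IsGeneric x)
    (ho : ∀ (n : ℕ) (s : Fin n → ℕ), Function.Injective s →
      {k | StrictMono fun i => x (s i) k}.Infinite) : IsRado (Set.range x) := by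
  classical
  have hV : (Set.range x).Countable := Set.countable_range x
  have := hV.to_subtype
  refine ⟨hV, hd, fun δ hδ p hp0 hp1 => ?_⟩
  obtain ⟨S, hS, hSx⟩ := hx.exists_finset hδ
  have h := (ae_LARG_adj hV δ p).and (ae_LARG_isLocallyExtensible (δ := δ) hV hd hp0 hp1)
  -- Any graph with the two almost sure properties serves as the common isomorphism type.
  obtain ⟨R, hR, hRe⟩ := h.exists
  refine ⟨R, ?_⟩
  filter_upwards [h] with G hG
  refine nonempty_iso_of_isLocallyExtensible hδ (hasAllOrders_of_strictMono ho) ?_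
    (S.image fun i => ⟨x i, i, rfl⟩) ?_ ?_ hG.1 hR hG.2 hRe
  · rintro ⟨_, i, rfl⟩ ⟨_, j, rfl⟩ hij k
    exact hx.apply_ne (by rintro rfl; exact hij rfl) k
  · simp only [Finset.forall_mem_image]
    intro i hi j hj
    refine (hS i hi j hj).imp id ?_
    rintro rfl
    rfl
  · rintro ⟨_, i, rfl⟩ ⟨_, j, rfl⟩ hij k m hm
    exact Finset.mem_image_of_mem (fun i => (⟨x i, i, rfl⟩ : Set.range x))
      (hSx i j (by rintro rfl; exact hij rfl) k m hm)

lemma dense_range_ofFinsupp_rat :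
    Dense (Set.range fun f : ℕ →₀ ℚ => ofFinsupp (f.mapRange (fun q : ℚ => (q : ℝ)) (by simp))) := by
  classical
  rw [Metric.dense_iff]
  intro x ε hε
  have hq : ∀ k, ∃ q : ℚ, |(q : ℝ) - x k| < ε := fun k => by
    obtain ⟨q, h1, h2⟩ := exists_rat_btwn (show x k - ε < x k + ε by linarith)
    exact ⟨q, abs_lt.2 ⟨by linarith, by linarith⟩⟩
  choose q hq using hq
  refine ⟨_, ?_, Finsupp.onFinset (finite_setOf_le_abs hε x).toFinset
    (fun k => if ε ≤ |x k| then q k else 0) (fun k hk => ?_), rfl⟩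
  · rw [mem_ball_iff_norm, norm_lt_iff_forall_abs_lt hε]
    intro k
    rw [ZeroAtInftyContinuousMap.sub_apply, ofFinsupp_apply, Finsupp.mapRange_apply,
      Finsupp.onFinset_apply]
    split_ifs with h
    · exact hq k
    · simpa using h
  · simp only [Set.Finite.mem_toFinset, Set.mem_ofPred_eq]
    by_contra h
    simp [h] at hk

/-! ### Almost sure properties of the sampled points -/

variable [MeasurableSpace C₀(ℕ, ℝ)] [BorelSpace C₀(ℕ, ℝ)] {μ : Measure C₀(ℕ, ℝ)}
  [IsProbabilityMeasure μ]

lemma ae_dense_range (hfs : FullySupported μ) :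
    ∀ᵐ x ∂(Measure.infinitePi fun _ : ℕ => μ), Dense (Set.range x) := by
  have h : ∀ᵐ x ∂(Measure.infinitePi fun _ : ℕ => μ), ∀ (f : ℕ →₀ ℚ) (n : ℕ), ∃ i,
      x i ∈ Metric.ball (ofFinsupp (f.mapRange (fun q : ℚ => (q : ℝ)) (by simp)))
        (1 / ((n : ℝ) + 1)) := by
    rw [ae_all_iff]
    intro f
    rw [ae_all_iff]
    intro n
    have hpos := hfs (Metric.ball (ofFinsupp (f.mapRange (fun q : ℚ => (q : ℝ)) (by simp)))
      (1 / ((n : ℝ) + 1))) Metric.isOpen_ball ⟨_, Metric.mem_ball_self Nat.one_div_pos_of_nat⟩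
    have := ae_frequently_mem_boxes (fun _ : ℕ => μ) _ (fun _ => measurableSet_ball)
      (fun i => {i}) (fun i j hij => by simpa using hij) _ hpos.ne'
      (fun i => (Finset.prod_singleton _ _).ge)
    filter_upwards [this] with x hx
    obtain ⟨i, hi⟩ := hx.exists
    exact ⟨i, hi i (by simp)⟩
  filter_upwards [h] with x hx
  rw [Metric.dense_iff]
  intro y ε hε
  obtain ⟨n, hn⟩ := exists_nat_one_div_lt (half_pos hε)
  obtain ⟨_, hz, f, rfl⟩ := Metric.dense_iff.1 dense_range_ofFinsupp_rat y (ε / 2) (half_pos hε)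
  obtain ⟨i, hi⟩ := hx f n
  refine ⟨x i, ?_, i, rfl⟩
  rw [Metric.mem_ball] at *
  linarith [dist_triangle (x i) (ofFinsupp (f.mapRange (fun q : ℚ => (q : ℝ)) (by simp))) y]

/-- There are countably many relations, since `q` is rational; in each, the left side is atomless
and independent of the right side, which involves only other samples. -/
lemma ae_isGeneric (hna : NonAligned μ) :
    ∀ᵐ x ∂(Measure.infinitePi fun _ : ℕ => μ), IsGeneric x := by
  have hev : ∀ k, Measurable fun y : C₀(ℕ, ℝ) => y k := fun k =>
    (continuous_eval_coord k).measurable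
  simp only [IsGeneric, ae_all_iff]
  intro i j i' j' k k' q hij hii' hij'
  have hN : NullSingletonClass
      ((Measure.infinitePi fun _ : ℕ => μ).map fun x => x i k) := by
    have : (Measure.infinitePi fun _ : ℕ => μ).map (fun x => x i k) = μ.map fun y => y k := by
      conv_rhs => rw [← Measure.infinitePi_map_eval (fun _ : ℕ => μ) i,
        Measure.map_map (hev k) (by fun_prop)]
      rfl
    refine ⟨fun α => ?_⟩
    rw [this, Measure.map_apply (hev k) (measurableSet_singleton α)]
    exact hna k α
  have hind := (iIndepFun_infinitePi (P := fun _ : ℕ => μ) (X := fun _ y => y)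
    (fun _ => measurable_id)).indepFun_finset {i} {j, i', j'} (by simp [hij, hii', hij'])
    (fun l => measurable_pi_apply l)
  refine ae_ne_of_indepFun (X := fun x : ℕ → C₀(ℕ, ℝ) => x i k)
    (Y := fun x => x j k + q * (x i' k' - x j' k')) ((hev k).comp (measurable_pi_apply i))
    (((hev k).comp (measurable_pi_apply j)).add (measurable_const.mul
      (((hev k').comp (measurable_pi_apply i')).sub ((hev k').comp (measurable_pi_apply j')))))
    (hind.comp (φ := fun y : ({i} : Finset ℕ) → C₀(ℕ, ℝ) => y ⟨i, by simp⟩ k)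
      (ψ := fun y : ({j, i', j'} : Finset ℕ) → C₀(ℕ, ℝ) => y ⟨j, by simp⟩ k + q * (y ⟨i', by simp⟩ k' - y ⟨j', by simp⟩ k')) ?_ ?_)
  · exact (hev k).comp (measurable_pi_apply _)
  · exact ((hev k).comp (measurable_pi_apply _)).add (measurable_const.mul
      (((hev k').comp (measurable_pi_apply _)).sub ((hev k').comp (measurable_pi_apply _))))

/-- Non-alignment makes every factor `ν k` atomless, so the statement can be pulled back from
product measures on ℝ^ℕ. -/
lemma ae_forall_infinite_strictMono (hna : NonAligned μ) (hpt : IsProductType μ) :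
    ∀ᵐ x ∂(Measure.infinitePi fun _ : ℕ => μ), ∀ (n : ℕ) (s : Fin n → ℕ),
      Function.Injective s → {k | StrictMono fun i => x (s i) k}.Infinite := by
  obtain ⟨ν, hν, hμν⟩ := hpt
  have hev : ∀ k, Measurable fun y : C₀(ℕ, ℝ) => y k := fun k =>
    (continuous_eval_coord k).measurable
  have hΦ : Measurable fun (y : C₀(ℕ, ℝ)) (n : ℕ) => y n := measurable_pi_iff.2 hev
  have hN : ∀ k, NullSingletonClass (ν k) := fun k => by
    refine ⟨fun α => ?_⟩
    rw [← Measure.infinitePi_map_eval ν k, ← hμν, Measure.map_map (measurable_pi_apply k) hΦ,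
      Measure.map_apply ((measurable_pi_apply k).comp hΦ) (measurableSet_singleton α)]
    exact hna k α
  have hmap := Measure.infinitePi_map_pi (fun _ : ℕ => μ) (fun _ => hΦ)
  rw [hμν] at hmap
  simp only [ae_all_iff]
  intro n s hs
  have h := ae_infinite_strictMono ν hs
  rw [← hmap] at h
  exact ae_of_ae_map (measurable_pi_iff.2 fun i => hΦ.comp (measurable_pi_apply i)).aemeasurable h

end RadoSets


theorem theorem2 [MeasurableSpace C₀(ℕ, ℝ)] [BorelSpace C₀(ℕ, ℝ)]
    (μ : Measure C₀(ℕ, ℝ)) [IsProbabilityMeasure μ]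
    (hna : RadoSets.NonAligned μ) (hfs : RadoSets.FullySupported μ)
    (hpt : RadoSets.IsProductType μ) :
    ∀ᵐ x : ℕ → C₀(ℕ, ℝ) ∂(Measure.infinitePi fun _ : ℕ => μ),
      RadoSets.IsRado (Set.range x) := by
  filter_upwards [RadoSets.ae_dense_range hfs, RadoSets.ae_isGeneric hna,
    RadoSets.ae_forall_infinite_strictMono hna hpt] with x hd hx ho
  exact RadoSets.isRado_range hd hx ho
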